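/- Let $G$ be a finite group. A \emph{complete $G$-universe} is a real inner product space $\mathcal U$ of countable dimension with an action of $G$ by linear isometries in which every finite-dimensional orthogonal representation of $G$ occurs infinitely often, i.e. embeds as an infinite sequence of pairwise orthogonal copies. Fix one. A map to $\mathcal U$ from a compact manifold with corners is called smooth if it lands in a finite-dimensional subspace and is smooth. A \emph{compact smooth $G$-manifold with corners} is a compact Hausdorff second-countable smooth manifold $M$, locally modeled on $[0,\infty)^n$ for some $n \geq 0$, with a smooth action of $G$ such that for each $x \in M$ the stabilizer $G_x$ acts trivially on the set of local boundary components of $M$ at $x$. The simplex $\Delta^p$ has the smooth structure inherited from $\mathbb R^{p+1}$. A smooth embedding is a smooth map that is a topological embedding and whose derivative is injective at every point. \begin{itemize} \item Let $\mathcal L(\mathcal U,\mathcal U)$ be the simplicial set whose $p$-simplices are the families $f = (f_t)_{t \in \Delta^p}$ of $G$-equivariant linear isometries $f_t \colon \mathcal U \to \mathcal U$ (not necessarily surjective) such that for every finite-dimensional subspace $V \subseteq \mathcal U$ the map $V \times \Delta^p \to \mathcal U$, $(v,t) \mapsto f_t(v)$, lands in a finite-dimensional subspace and is smooth. \item For compact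 smooth $G$-manifolds with corners $M_0, M_1$, let $\mathrm{Sm}(M_0,M_1)$ be the simplicial set whose $p$-simplices are the $G$-equivariant smooth maps $M_0 \times \Delta^p \to M_1$. \item Let $\mathrm{Emb}(M_0, M_1 \times \mathcal U)$ be the simplicial set whose $p$-simplices are the $G$-equivariant smooth maps $e = (e^{(1)},e^{(2)}) \colon M_0 \times \Delta^p \to M_1 \times \mathcal U$ landing in $M_1 \times V$ for some finite-dimensional subspace $V \subseteq \mathcal U$, such that $e_t = e(-,t)\colon M_0 \to M_1 \times \mathcal U$ is a smooth embedding for every $t \in \Delta^p$. \item Let $\mathcal M^{\mathcal U\text{-}\mathrm{Emb}}(M_0,M_1) \subseteq \mathcal L(\mathcal U,\mathcal U) \times \mathrm{Emb}(M_0,M_1 \times \mathcal U)$ be the simplicial subset of those pairs $(f,e)$ such that $e^{(2)}_t(x) \in f_t(\mathcal U)^\perp$ for all $x \in M_0$ and $t \in \Delta^p$. \end{itemize} Then: \begin{enumerate} \item The simplicial set $\mathcal L(\mathcal U,\mathcal U)$ is contractible, i.e. its map to a point is a weak equivalence of simplicial sets. \item For all compact smooth $G$-manifolds with corners $M_0$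 and $M_1$, the forgetful map \[ \mathcal M^{\mathcal U\text{-}\mathrm{Emb}}(M_0,M_1) \to \mathrm{Sm}(M_0,M_1), \qquad (f,e) \mapsto e^{(1)}, \] is a weak equivalence of simplicial sets. \end{enumerate} -/

import Mathlib

open CategoryTheory MonoidalCategory Simplicial
open scoped ContDiff RealInnerProductSpace

universe u v

namespace UEmbeddings

/-! ### Weak equivalences of simplicial sets -/

/-- The relation "there is a simplicial homotopy from `a` to `b`". -/
def HomotopyRel {X Z : SSet.{u}} (a b : X ⟶ Z) : Prop :=
  Nonempty (SSet.Homotopy a b)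

theorem HomotopyRel.precomp {X Y Z : SSet.{u}} (f : X ⟶ Y) {a b : Y ⟶ Z}
    (h : HomotopyRel a b) : HomotopyRel (f ≫ a) (f ≫ b) := by
  obtain ⟨H⟩ := h
  refine ⟨{ h := f ▷ Δ[1] ≫ H.h, h₀ := ?_, h₁ := ?_, rel := ?_ }⟩
  · simp [SSet.ι₀_comp_assoc]
  · simp [SSet.ι₁_comp_assoc]
  · ext _ ⟨⟨_, h⟩, _⟩
    exact h.elim

/-- The set `[X, Z]` of simplicial maps modulo the equivalence relation generated by simplicial
homotopy, that is, the set of components of the function complex from `X` to `Z`. -/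
def HomotopyClass (X Z : SSet.{u}) : Type u :=
  Quot (HomotopyRel (X := X) (Z := Z))

/-- Precomposition with `f`, as a map `[Y, Z] → [X, Z]`. -/
def HomotopyClass.precomp {X Y : SSet.{u}} (f : X ⟶ Y) (Z : SSet.{u}) :
    HomotopyClass Y Z → HomotopyClass X Z :=
  Quot.map (fun a => f ≫ a) (fun _ _ h => h.precomp f)

/-- Weak (homotopy) equivalences of simplicial sets: precomposition with `f` is a bijection
`[Y, Z] → [X, Z]` for every Kan complex `Z`. Equivalently, the geometric realization of `f` is a
(weak) homotopy equivalence. -/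
def IsWeakEquivalence {X Y : SSet.{u}} (f : X ⟶ Y) : Prop :=
  ∀ Z : SSet.{u}, SSet.KanComplex Z → Function.Bijective (HomotopyClass.precomp f Z)

/-- A space, given as a simplicial set, is contractible if its map to a point is a weak
equivalence. -/
def IsContractible (X : SSet.{u}) : Prop :=
  IsWeakEquivalence (Limits.terminal.from X)

/-! ### Smooth families parametrized by a simplex -/

/-- The standard `p`-simplex in `ℝ^{p+1}`. -/
abbrev Simplex (p : ℕ) : Type := stdSimplex ℝ (Fin (p + 1))

section Family

variable {E : Type*} [NormedAddCommGroup E] [NormedSpace ℝ E] {H : Type*} [TopologicalSpace H]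
  (I : ModelWithCorners ℝ E H) {X : Type*} [TopologicalSpace X] [ChartedSpace H X]
  {E' : Type*} [NormedAddCommGroup E'] [NormedSpace ℝ E'] {H' : Type*} [TopologicalSpace H']
  (J : ModelWithCorners ℝ E' H') {Y : Type*} [TopologicalSpace Y] [ChartedSpace H' Y]

/-- The map `X × Δ^p → Y`, `(x, t) ↦ f x t`, is smooth, where `Δ^p` has the smooth structure
inherited from `ℝ^{p+1}`. The function `F` is only used to write the map as a function on the
subset `X × Δ^p` of `X × ℝ^{p+1}`; its values elsewhere do not matter. -/
def IsSmoothFamily {p : ℕ} (f : X → Simplex p → Y) : Prop :=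
  ∃ F : X × (Fin (p + 1) → ℝ) → Y,
    ContMDiffOn (I.prod (modelWithCornersSelf ℝ (Fin (p + 1) → ℝ))) J ∞ F
      (Set.univ ×ˢ stdSimplex ℝ (Fin (p + 1))) ∧
    ∀ x t, F (x, t.1) = f x t

variable {I J}

theorem IsSmoothFamily.reindex {p q : ℕ} {f : X → Simplex p → Y} (hf : IsSmoothFamily I J f)
    (θ : Fin (q + 1) → Fin (p + 1)) :
    IsSmoothFamily I J (fun x (t : Simplex q) => f x (stdSimplex.map θ t)) := by
  obtain ⟨F, hF, hFf⟩ := hf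
  let L : (Fin (q + 1) → ℝ) →L[ℝ] (Fin (p + 1) → ℝ) :=
    LinearMap.toContinuousLinearMap (FunOnFinite.linearMap ℝ ℝ θ)
  refine ⟨fun z => F (z.1, L z.2), ?_, fun x t => hFf x (stdSimplex.map θ t)⟩
  refine hF.comp (t := Set.univ ×ˢ stdSimplex ℝ (Fin (p + 1))) ?_ ?_
  · exact (contMDiff_fst.prodMk (L.contMDiff.comp contMDiff_snd)).contMDiffOn
  · rintro ⟨x, t⟩ ⟨-, ht⟩
    exact ⟨trivial, (stdSimplex.map θ ⟨t, ht⟩).2⟩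

end Family

/-! ### Compact `G`-manifolds with corners -/

/-- A compact smooth `G`-manifold with corners, of dimension `dim`, with an action of `G` that is
trivial on corners. -/
structure GManifold (G : Type v) [Group G] where
  carrier : Type u
  dim : ℕ
  [topologicalSpace : TopologicalSpace carrier]
  [chartedSpace : ChartedSpace (EuclideanQuadrant dim) carrier]
  [isManifold : IsManifold (modelWithCornersEuclideanQuadrant dim) ∞ carrier]
  [t2Space : T2Space carrier]
  [secondCountable : SecondCountableTopology carrier]
  [compactSpace : CompactSpace carrier]
  [action : MulAction G carrier]
  smooth_smul : ∀ g : G, ContMDiff (modelWithCornersEuclideanQuadrant dim)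
    (modelWithCornersEuclideanQuadrant dim) ∞ (fun x : carrier => g • x)
  /-- The stabilizer of a point `x` acts trivially on the set of local boundary components at `x`.
  In a chart at `x`, these are the local hypersurfaces `y i = 0`, for the indices `i` for which the
  `i`-th coordinate of `x` vanishes. -/
  trivial_on_corners : ∀ (x : carrier) (g : G), g • x = x → ∀ i : Fin dim,
    (chartAt (EuclideanQuadrant dim) x x).1 i = 0 →
    ∀ᶠ y in nhds x, (chartAt (EuclideanQuadrant dim) x (g • y)).1 i = 0 ↔
      (chartAt (EuclideanQuadrant dim) x y).1 i = 0

namespace GManifold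

variable {G : Type v} [Group G]

instance : CoeSort (GManifold.{u} G) (Type u) := ⟨carrier⟩

attribute [instance] topologicalSpace chartedSpace isManifold t2Space secondCountable
  compactSpace action

/-- The model with corners of `M`, with values in the quadrant `[0, ∞)^dim`. -/
noncomputable abbrev model (M : GManifold.{u} G) :
    ModelWithCorners ℝ (EuclideanSpace ℝ (Fin M.dim)) (EuclideanQuadrant M.dim) :=
  modelWithCornersEuclideanQuadrant M.dim

end GManifold

/-! ### The smooth mapping space -/

section Sm

variable {G : Type v} [Group G]

/-- A `p`-simplex of `Sm(M₀, M₁)`: an equivariant smooth map `M₀ × Δ^p → M₁`. -/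
@[ext]
structure SmSimplex (M₀ M₁ : GManifold.{u} G) (p : ℕ) : Type u where
  toFun : M₀ → Simplex p → M₁
  smooth : IsSmoothFamily M₀.model M₁.model toFun
  equivariant : ∀ (g : G) (x : M₀) (t : Simplex p), toFun (g • x) t = g • toFun x t

/-- The action of simplicial operators: reparametrization of the simplex. -/
noncomputable def SmSimplex.reindex {M₀ M₁ : GManifold.{u} G} {p q : ℕ} (σ : SmSimplex M₀ M₁ p)
    (θ : Fin (q + 1) → Fin (p + 1)) : SmSimplex M₀ M₁ q where
  toFun x t := σ.toFun x (stdSimplex.map θ t)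
  smooth := σ.smooth.reindex θ
  equivariant g x _ := σ.equivariant g x _

theorem SmSimplex.reindex_id {M₀ M₁ : GManifold.{u} G} {p : ℕ} (σ : SmSimplex M₀ M₁ p) :
    σ.reindex id = σ := by
  ext x t
  exact congrArg (σ.toFun x) (stdSimplex.map_id_apply t)

theorem SmSimplex.reindex_comp {M₀ M₁ : GManifold.{u} G} {p q r : ℕ} (σ : SmSimplex M₀ M₁ p)
    (θ : Fin (q + 1) → Fin (p + 1)) (η : Fin (r + 1) → Fin (q + 1)) :
    σ.reindex (θ ∘ η) = (σ.reindex θ).reindex η := by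
  ext x t
  exact congrArg (σ.toFun x) (stdSimplex.map_comp_apply _ _ t).symm

/-- The simplicial set `Sm(M₀, M₁)` of equivariant smooth maps. -/
noncomputable def Sm (M₀ M₁ : GManifold.{u} G) : SSet.{u} where
  obj n := SmSimplex M₀ M₁ n.unop.len
  map θ := ↾fun σ => σ.reindex θ.unop.toOrderHom
  map_id _ := ConcreteCategory.hom_ext _ _ fun σ => SmSimplex.reindex_id σ
  map_comp θ η := ConcreteCategory.hom_ext _ _ fun σ =>
    SmSimplex.reindex_comp σ θ.unop.toOrderHom η.unop.toOrderHom

end Sm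

/-! ### Universes and linear isometries -/

section Universe

variable {G : Type v} [Group G] {U : Type u} [NormedAddCommGroup U] [InnerProductSpace ℝ U]

/-- `U`, with the action `ρ` of `G` by linear isometries, is a complete `G`-universe: a real inner
product space of countable dimension in which every finite-dimensional orthogonal representation
of `G` occurs infinitely often, as pairwise orthogonal subrepresentations. ("Complete" does not
refer to the norm of `U`.) -/
structure IsCompleteUniverse (ρ : G →* (U ≃ₗᵢ[ℝ] U)) : Prop where
  rank_le : Module.rank ℝ U ≤ Cardinal.aleph0
  exists_copies : ∀ (n : ℕ)
    (σ : G →* (EuclideanSpace ℝ (Fin n) ≃ₗᵢ[ℝ] EuclideanSpace ℝ (Fin n))),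
    ∃ j : ℕ → (EuclideanSpace ℝ (Fin n) →ₗᵢ[ℝ] U),
      (∀ k g v, j k (σ g v) = ρ g (j k v)) ∧
      ∀ k l, k ≠ l → ∀ v w, ⟪j k v, j l w⟫ = 0

variable (ρ : G →* (U ≃ₗᵢ[ℝ] U))

/-- A `p`-simplex of `L(U, U)`: a family of equivariant linear isometries `U → U` (not necessarily
surjective) parametrized by `Δ^p`, whose restriction to `V × Δ^p` is, for every finite-dimensional
subspace `V` of `U`, a smooth map into some finite-dimensional subspace `W` of `U`. -/
@[ext]
structure IsometrySimplex (p : ℕ) : Type u where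
  toFun : Simplex p → (U →ₗᵢ[ℝ] U)
  equivariant : ∀ (t : Simplex p) (g : G) (v : U), toFun t (ρ g v) = ρ g (toFun t v)
  smooth : ∀ V : Submodule ℝ U, FiniteDimensional ℝ V →
    IsSmoothFamily (modelWithCornersSelf ℝ V) (modelWithCornersSelf ℝ U) (fun (v : V) (t : Simplex p) => toFun t v) ∧
    ∃ W : Submodule ℝ U, FiniteDimensional ℝ W ∧ ∀ t, ∀ v ∈ V, toFun t v ∈ W

variable {ρ} in
/-- The action of simplicial operators: reparametrization of the simplex. -/
noncomputable def IsometrySimplex.reindex {p q : ℕ} (σ : IsometrySimplex ρ p)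
    (θ : Fin (q + 1) → Fin (p + 1)) : IsometrySimplex ρ q where
  toFun t := σ.toFun (stdSimplex.map θ t)
  equivariant _ g v := σ.equivariant _ g v
  smooth V hV := by
    obtain ⟨h, W, hW, hVW⟩ := σ.smooth V hV
    exact ⟨h.reindex θ, W, hW, fun _ v hv => hVW _ v hv⟩

variable {ρ} in
theorem IsometrySimplex.reindex_id {p : ℕ} (σ : IsometrySimplex ρ p) : σ.reindex id = σ := by
  ext t v
  exact congrArg (fun s => σ.toFun s v) (stdSimplex.map_id_apply t)

variable {ρ} in
theorem IsometrySimplex.reindex_comp {p q r : ℕ} (σ : IsometrySimplex ρ p)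
    (θ : Fin (q + 1) → Fin (p + 1)) (η : Fin (r + 1) → Fin (q + 1)) :
    σ.reindex (θ ∘ η) = (σ.reindex θ).reindex η := by
  ext t v
  exact congrArg (fun s => σ.toFun s v) (stdSimplex.map_comp_apply _ _ t).symm

/-- The simplicial set `L(U, U)` of smooth families of equivariant linear isometries. -/
noncomputable def L : SSet.{u} where
  obj n := IsometrySimplex ρ n.unop.len
  map θ := ↾fun σ => σ.reindex θ.unop.toOrderHom
  map_id _ := ConcreteCategory.hom_ext _ _ fun σ => IsometrySimplex.reindex_id σ
  map_comp θ η := ConcreteCategory.hom_ext _ _ fun σ =>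
    IsometrySimplex.reindex_comp σ θ.unop.toOrderHom η.unop.toOrderHom

/-! ### Embeddings into `M₁ × U`, and `U`-embeddings -/

/-- A smooth embedding: a smooth map that is a topological embedding and whose derivative is
injective at every point. -/
structure IsSmoothEmb {E : Type*} [NormedAddCommGroup E] [NormedSpace ℝ E] {H : Type*}
    [TopologicalSpace H] (I : ModelWithCorners ℝ E H) {X : Type*} [TopologicalSpace X]
    [ChartedSpace H X] {E' : Type*} [NormedAddCommGroup E'] [NormedSpace ℝ E'] {H' : Type*}
    [TopologicalSpace H'] (J : ModelWithCorners ℝ E' H') {Y : Type*} [TopologicalSpace Y]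
    [ChartedSpace H' Y] (f : X → Y) : Prop where
  contMDiff : ContMDiff I J ∞ f
  isEmbedding : Topology.IsEmbedding f
  injective_mfderiv : ∀ x, Function.Injective (mfderiv I J f x)

/-- A `p`-simplex of `Emb(M₀, M₁ × U)`: an equivariant smooth map `M₀ × Δ^p → M₁ × U`, landing in
`M₁ × V` for some finite-dimensional subspace `V` of `U` (equivalently, since `M₀ × Δ^p` is compact,
in a compact submanifold of `M₁ × U`), which for every point of `Δ^p` is a smooth embedding. -/
@[ext]
structure EmbSimplex (M₀ M₁ : GManifold.{u} G) (p : ℕ) : Type u where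
  toFun : M₀ → Simplex p → M₁ × U
  smooth : IsSmoothFamily M₀.model (M₁.model.prod (modelWithCornersSelf ℝ U)) toFun
  finite : ∃ V : Submodule ℝ U, FiniteDimensional ℝ V ∧ ∀ x t, (toFun x t).2 ∈ V
  equivariant_fst : ∀ (g : G) (x : M₀) (t : Simplex p), (toFun (g • x) t).1 = g • (toFun x t).1
  equivariant_snd : ∀ (g : G) (x : M₀) (t : Simplex p), (toFun (g • x) t).2 = ρ g (toFun x t).2
  isSmoothEmb : ∀ t, IsSmoothEmb M₀.model (M₁.model.prod (modelWithCornersSelf ℝ U)) (fun x => toFun x t)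

variable {ρ} in
/-- The action of simplicial operators: reparametrization of the simplex. -/
noncomputable def EmbSimplex.reindex {M₀ M₁ : GManifold.{u} G} {p q : ℕ}
    (σ : EmbSimplex ρ M₀ M₁ p) (θ : Fin (q + 1) → Fin (p + 1)) : EmbSimplex ρ M₀ M₁ q where
  toFun x t := σ.toFun x (stdSimplex.map θ t)
  smooth := σ.smooth.reindex θ
  finite := by
    obtain ⟨V, hV, h⟩ := σ.finite
    exact ⟨V, hV, fun x _ => h x _⟩
  equivariant_fst g x _ := σ.equivariant_fst g x _
  equivariant_snd g x _ := σ.equivariant_snd g x _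
  isSmoothEmb _ := σ.isSmoothEmb _

variable {ρ} in
theorem EmbSimplex.reindex_id {M₀ M₁ : GManifold.{u} G} {p : ℕ} (σ : EmbSimplex ρ M₀ M₁ p) :
    σ.reindex id = σ :=
  EmbSimplex.ext (funext fun x => funext fun t =>
    congrArg (σ.toFun x) (stdSimplex.map_id_apply t))

variable {ρ} in
theorem EmbSimplex.reindex_comp {M₀ M₁ : GManifold.{u} G} {p q r : ℕ}
    (σ : EmbSimplex ρ M₀ M₁ p) (θ : Fin (q + 1) → Fin (p + 1)) (η : Fin (r + 1) → Fin (q + 1)) :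
    σ.reindex (θ ∘ η) = (σ.reindex θ).reindex η :=
  EmbSimplex.ext (funext fun x => funext fun t =>
    congrArg (σ.toFun x) (stdSimplex.map_comp_apply _ _ t).symm)

/-- The simplicial set `Emb(M₀, M₁ × U)`. -/
noncomputable def Emb (M₀ M₁ : GManifold.{u} G) : SSet.{u} where
  obj n := EmbSimplex ρ M₀ M₁ n.unop.len
  map θ := ↾fun σ => σ.reindex θ.unop.toOrderHom
  map_id _ := ConcreteCategory.hom_ext _ _ fun σ => EmbSimplex.reindex_id σ
  map_comp θ η := ConcreteCategory.hom_ext _ _ fun σ =>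
    EmbSimplex.reindex_comp σ θ.unop.toOrderHom η.unop.toOrderHom

/-- The space of `U`-embeddings from `M₀` to `M₁`, as a simplicial subset of
`L(U, U) × Emb(M₀, M₁ × U)`: the pairs of an isometry `f` and an embedding `e` whose second
coordinate lands in the orthogonal complement of `f(U)`, for every point of the simplex. -/
noncomputable def UEmbSubcomplex (M₀ M₁ : GManifold.{u} G) : (L ρ ⊗ Emb ρ M₀ M₁).Subcomplex where
  obj n := {s | ∀ (x : M₀) (t : Simplex n.unop.len),
    (s.2.toFun x t).2 ∈ (LinearMap.range (s.1.toFun t).toLinearMap)ᗮ}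
  map _ _ hs x _ := hs x _

/-- The space of `U`-embeddings from `M₀` to `M₁`. -/
noncomputable abbrev UEmb (M₀ M₁ : GManifold.{u} G) : SSet.{u} :=
  (UEmbSubcomplex ρ M₀ M₁ : SSet.{u})

theorem IsSmoothFamily.fst {E : Type*} [NormedAddCommGroup E] [NormedSpace ℝ E] {H : Type*}
    [TopologicalSpace H] {I : ModelWithCorners ℝ E H} {X : Type*} [TopologicalSpace X]
    [ChartedSpace H X] {E' : Type*} [NormedAddCommGroup E'] [NormedSpace ℝ E'] {H' : Type*}
    [TopologicalSpace H'] {J : ModelWithCorners ℝ E' H'} {Y : Type*} [TopologicalSpace Y]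
    [ChartedSpace H' Y] {p : ℕ} {f : X → Simplex p → Y × U}
    (hf : IsSmoothFamily I (J.prod (modelWithCornersSelf ℝ U)) f) :
    IsSmoothFamily I J (fun x t => (f x t).1) := by
  obtain ⟨F, hF, hFf⟩ := hf
  refine ⟨fun z => (F z).1, ?_, fun x t => congrArg Prod.fst (hFf x t)⟩
  exact contMDiff_fst.comp_contMDiffOn hF

/-- The projection `Emb(M₀, M₁ × U) ⟶ Sm(M₀, M₁)`, `e ↦ e⁽¹⁾`. -/
noncomputable def embToSm (M₀ M₁ : GManifold.{u} G) : Emb ρ M₀ M₁ ⟶ Sm M₀ M₁ where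
  app _ := ↾fun σ =>
    { toFun := fun x t => (σ.toFun x t).1
      smooth := σ.smooth.fst
      equivariant := σ.equivariant_fst }
  naturality _ _ _ := rfl

/-- The forgetful map `(f, e) ↦ e⁽¹⁾` from `U`-embeddings to smooth maps. -/
noncomputable def forget (M₀ M₁ : GManifold.{u} G) : UEmb ρ M₀ M₁ ⟶ Sm M₀ M₁ :=
  (UEmbSubcomplex ρ M₀ M₁).ι ≫ CartesianMonoidalCategory.snd _ _ ≫ embToSm ρ M₀ M₁

end Universe

end UEmbeddings

namespace UEmbeddings

/-! ### Homotopy equivalences of simplicial sets -/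

/-! Both maps have explicit homotopy inverses: each has a section whose composite with it is
simplicially homotopic to the identity (`IsWeakEquivalence.of_section`). The geometric input is a
`Deformation`: a path of equivariant isometries of the universe that starts at the identity and
whose image, from time 1/2 on, is orthogonal to the images of two further isometries `left` and
`right`, themselves orthogonal to each other.

Given a deformation, an isometry `f` is first carried along the path and then rotated into `right`,
which contracts the space of isometries. An embedding `e` moves in parallel: its first component is
kept, while its second is carried along the same path and rotated into `left ∘ i`, for a fixed
equivariant embedding `i` of `M₀` into the universe. Orthogonality to the isometry persists
throughout (`Deformation.inner_push`). As soon as the summand `left ∘ i` appears, it alone makes the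
map an embedding, whatever the first component (`IsSmoothEmb.combine`). The end of the homotopy
depends only on the first component, so it is a section applied to the forgetful map.

To construct a deformation (`IsCompleteUniverse.nonempty_deformation`), the universe is exhausted by
finite-dimensional invariant subspaces, and each graded piece receives three new copies, all copies
pairwise orthogonal. The path rotates each piece into its first copy; the other two copies define
`left` and `right`. A copy of an early piece need not be orthogonal to later pieces, so later pieces
turn first, at times accumulating at 0. The path is still smooth there, since a finite-dimensional
subspace meets only finitely many of the rotations. The embedding `i` is a Whitney embedding made
equivariant by recording its values along orbits. -/

theorem HomotopyRel.postcomp {X Y Z : SSet.{u}} {a b : X ⟶ Y} (h : HomotopyRel a b) (f : Y ⟶ Z) :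
    HomotopyRel (a ≫ f) (b ≫ f) := by
  obtain ⟨H⟩ := h
  refine ⟨{ h := H.h ≫ f, h₀ := ?_, h₁ := ?_, rel := ?_ }⟩
  · simp
  · simp
  · ext _ ⟨⟨_, h⟩, _⟩
    exact h.elim

/-- A map that has a section, and for which the section is a homotopy left inverse, is a weak
equivalence. -/
theorem IsWeakEquivalence.of_section {X Y : SSet.{u}} {f : X ⟶ Y} (g : Y ⟶ X)
    (hg : g ≫ f = 𝟙 Y) (h : HomotopyRel (𝟙 X) (f ≫ g)) : IsWeakEquivalence f := by
  intro Z _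
  constructor
  · refine Function.LeftInverse.injective (g := HomotopyClass.precomp g Z) ?_
    rintro ⟨a⟩
    change Quot.mk _ (g ≫ f ≫ a) = Quot.mk _ a
    rw [← Category.assoc, hg, Category.id_comp]
  · rintro ⟨a⟩
    refine ⟨Quot.mk _ (g ≫ a), (Quot.sound ?_).symm⟩
    simpa using h.postcomp a

/-- A homotopy, given by a family of maps that is indexed by the simplices of `Δ[1]`. -/
theorem HomotopyRel.of_family {X Y : SSet.{u}} {a b : X ⟶ Y}
    (H : ∀ n : SimplexCategoryᵒᵖ, X.obj n → (Fin (n.unop.len + 1) → Fin 2) → Y.obj n)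
    (naturality : ∀ (n m : SimplexCategoryᵒᵖ) (θ : n ⟶ m) (x : X.obj n)
      (α : Fin (n.unop.len + 1) → Fin 2),
      H m (X.map θ x) (α ∘ θ.unop.toOrderHom) = Y.map θ (H n x α))
    (h₀ : ∀ n x, H n x (fun _ => 0) = a.app n x) (h₁ : ∀ n x, H n x (fun _ => 1) = b.app n x) :
    HomotopyRel a b := by
  refine ⟨{
    -- A simplex of `Δ[1]` is a monotone map to `Fin 2`, and `H` is evaluated at its underlying
    -- function.
    h := { app := fun n => ↾fun x => H n x.1 (SSet.stdSimplex.objEquiv x.2).toOrderHom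
           naturality := fun n m θ => ConcreteCategory.hom_ext _ _ fun x =>
             naturality n m θ x.1 _ }
    h₀ := ?_, h₁ := ?_, rel := ?_ }⟩
  · ext n x
    exact h₀ _ x
  · ext n x
    exact h₁ _ x
  -- The homotopy is relative to the empty subcomplex, so this condition is vacuous.
  · ext _ ⟨⟨_, h⟩, _⟩
    exact h.elim

/-- The coordinate function on `Δ^p` of a map from `Δ^p` to the interval that is given on
vertices. -/
noncomputable def intervalCoord {p : ℕ} (α : Fin (p + 1) → Fin 2) (t : Simplex p) : ℝ :=
  (stdSimplex.map α t).1 1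

/-- This compatibility makes the homotopies below natural: the time at a point of a simplex is
unchanged by reindexing. -/
theorem intervalCoord_comp {p q : ℕ} (α : Fin (p + 1) → Fin 2) (θ : Fin (q + 1) → Fin (p + 1))
    (t : Simplex q) : intervalCoord (α ∘ θ) t = intervalCoord α (stdSimplex.map θ t) :=
  congrArg (fun s : Simplex 1 => s.1 1) (stdSimplex.map_comp_apply θ α t).symm

theorem intervalCoord_eq_sum {p : ℕ} (α : Fin (p + 1) → Fin 2) (t : Simplex p) :
    intervalCoord α t = ∑ i with α i = 1, t.1 i := by
  exact FunOnFinite.linearMap_apply_apply ℝ ℝ α t.1 1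

@[simp]
theorem intervalCoord_zero {p : ℕ} (t : Simplex p) :
    intervalCoord (fun _ : Fin (p + 1) => 0) t = 0 := by
  simp [intervalCoord_eq_sum]

@[simp]
theorem intervalCoord_one {p : ℕ} (t : Simplex p) :
    intervalCoord (fun _ : Fin (p + 1) => 1) t = 1 := by
  simpa [intervalCoord_eq_sum] using t.2.2

/-! ### Equivariant isometries into a complete universe -/

section Copies

variable {G : Type v} [Group G] {U : Type u} [NormedAddCommGroup U] [InnerProductSpace ℝ U]
  {ρ : G →* (U ≃ₗᵢ[ℝ] U)}

/-- An orthonormal basis transports the representation to a Euclidean space. -/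
theorem IsCompleteUniverse.exists_copies_of_finiteDimensional (hU : IsCompleteUniverse ρ)
    {E : Type*} [NormedAddCommGroup E] [InnerProductSpace ℝ E] [FiniteDimensional ℝ E]
    (σ : G →* (E ≃ₗᵢ[ℝ] E)) :
    ∃ j : ℕ → (E →ₗᵢ[ℝ] U), (∀ k g v, j k (σ g v) = ρ g (j k v)) ∧
      ∀ k l, k ≠ l → ∀ v w, ⟪j k v, j l w⟫ = 0 := by
  let b := (stdOrthonormalBasis ℝ E).repr
  let σ' : G →* (EuclideanSpace ℝ (Fin (Module.finrank ℝ E)) ≃ₗᵢ[ℝ] _) :=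
    { toFun := fun g => (b.symm.trans (σ g)).trans b
      map_one' := by ext1 v; simp
      map_mul' := fun g h => by ext1 v; simp }
  obtain ⟨j, hj, hj'⟩ := hU.exists_copies _ σ'
  refine ⟨fun k => (j k).comp b.toLinearIsometry, fun k g v => ?_, fun k l h v w => hj' k l h _ _⟩
  simpa [σ'] using hj k g (b v)

/-- Linear combinations, with coefficients of square sum one, of pairwise orthogonal isometries. -/
theorem exists_linearIsometry_sum {E : Type*} [NormedAddCommGroup E] [InnerProductSpace ℝ E]
    {ι : Type*} [Fintype ι] (j : ι → (E →ₗᵢ[ℝ] U))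
    (hj : ∀ k l, k ≠ l → ∀ v w, ⟪j k v, j l w⟫ = 0) (c : ι → ℝ) (hc : ∑ k, c k ^ 2 = 1) :
    ∃ J : E →ₗᵢ[ℝ] U, ∀ v, J v = ∑ k, c k • j k v := by
  classical
  refine ⟨LinearMap.isometryOfInner (∑ k, c k • (j k).toLinearMap) fun v w => ?_, fun v => by
    simp [LinearMap.isometryOfInner]⟩
  simp only [LinearMap.coe_sum, Finset.sum_apply, LinearMap.smul_apply,
    LinearIsometry.coe_toLinearMap, sum_inner, inner_sum, real_inner_smul_left,
    real_inner_smul_right]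
  rw [← one_mul ⟪v, w⟫, ← hc, Finset.sum_mul]
  refine Finset.sum_congr rfl fun k _ => ?_
  rw [Finset.sum_eq_single k (fun l _ hl => by rw [hj _ _ hl]; ring) (by simp),
    LinearIsometry.inner_map_map]
  ring

/-- Finitely many vectors of a vector space of smaller dimension have a linear relation whose
coefficients have square sum one. -/
theorem exists_relation_sq_sum_eq_one (W : Type*) [AddCommGroup W] [Module ℝ W]
    [FiniteDimensional ℝ W] :
    ∃ N : ℕ, ∀ w : Fin N → W, ∃ c : Fin N → ℝ, ∑ k, c k ^ 2 = 1 ∧ ∑ k, c k • w k = 0 := by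
  refine ⟨Module.finrank ℝ W + 1, fun w => ?_⟩
  have hw : ¬ LinearIndependent ℝ w := fun h => by
    have := h.fintype_card_le_finrank
    simp at this
  obtain ⟨c, hc, i, hi⟩ := Fintype.not_linearIndependent_iff.1 hw
  have hS : 0 < ∑ k, c k ^ 2 :=
    Finset.sum_pos' (fun k _ => sq_nonneg _) ⟨i, Finset.mem_univ _, by positivity⟩
  refine ⟨fun k => (√(∑ k, c k ^ 2))⁻¹ * c k, ?_, ?_⟩
  · simp only [mul_pow, inv_pow, Real.sq_sqrt hS.le]
    rw [← Finset.mul_sum, inv_mul_cancel₀ hS.ne']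
  · simp only [mul_smul]
    rw [← Finset.smul_sum, hc, smul_zero]

/-- Every finite-dimensional orthogonal representation embeds into the orthogonal complement of a
given finite-dimensional subspace of a complete universe. -/
theorem IsCompleteUniverse.exists_copy_orthogonal (hU : IsCompleteUniverse ρ)
    {E : Type*} [NormedAddCommGroup E] [InnerProductSpace ℝ E] [FiniteDimensional ℝ E]
    (σ : G →* (E ≃ₗᵢ[ℝ] E)) (K : Submodule ℝ U) [FiniteDimensional ℝ K] :
    ∃ j : E →ₗᵢ[ℝ] U, (∀ g v, j (σ g v) = ρ g (j v)) ∧ ∀ v, ∀ k ∈ K, ⟪k, j v⟫ = 0 := by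
  obtain ⟨j, hj, hj'⟩ := hU.exists_copies_of_finiteDimensional σ
  obtain ⟨N, hN⟩ := exists_relation_sq_sum_eq_one (E →ₗ[ℝ] K →ₗ[ℝ] ℝ)
  obtain ⟨c, hc, hc'⟩ := hN fun k => (innerₗ U).compl₁₂ (j k).toLinearMap K.subtype
  obtain ⟨J, hJ⟩ := exists_linearIsometry_sum (fun k : Fin N => j k)
    (fun k l h => hj' k l (fun h' => h (Fin.ext h'))) c hc
  refine ⟨J, fun g v => by simp [hJ, hj], fun v k hk => ?_⟩
  have := LinearMap.congr_fun (LinearMap.congr_fun hc' v) ⟨k, hk⟩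
  simp only [LinearMap.coe_sum, Finset.sum_apply, LinearMap.smul_apply, LinearMap.zero_apply,
    LinearMap.compl₁₂_apply, innerₗ_apply_apply, Submodule.subtype_apply, smul_eq_mul,
    LinearIsometry.coe_toLinearMap] at this
  simpa only [hJ, inner_sum, real_inner_smul_right, real_inner_comm k] using this

/-- The restriction of an orthogonal representation to an invariant subspace. -/
def subrepresentation (ρ : G →* (U ≃ₗᵢ[ℝ] U)) (V : Submodule ℝ U) (hV : ∀ g, ∀ v ∈ V, ρ g v ∈ V) :
    G →* (V ≃ₗᵢ[ℝ] V) where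
  toFun g :=
    { toFun := fun v => ⟨ρ g v, hV g v v.2⟩
      invFun := fun v => ⟨ρ g⁻¹ v, hV g⁻¹ v v.2⟩
      left_inv := fun v => by ext; simp
      right_inv := fun v => by ext; simp
      map_add' := fun v w => by ext; simp
      map_smul' := fun c v => by ext; simp
      norm_map' := fun v => (ρ g).norm_map v }
  map_one' := by ext v; simp
  map_mul' g h := by ext v; simp

/-- A complete universe is the union of an increasing sequence of finite-dimensional invariant
subspaces. -/
theorem IsCompleteUniverse.exists_filtration [Finite G] (hU : IsCompleteUniverse ρ) :
    ∃ F : ℕ → Submodule ℝ U, Monotone F ∧ F 0 = ⊥ ∧ (∀ n, FiniteDimensional ℝ (F n)) ∧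
      (∀ n g, ∀ v ∈ F n, ρ g v ∈ F n) ∧
      ∀ V : Submodule ℝ U, FiniteDimensional ℝ V → ∃ n, V ≤ F n := by
  let b := Module.Free.chooseBasis ℝ U
  have hb : (Set.range b).Countable := by
    have : Countable (Module.Free.ChooseBasisIndex ℝ U) := by
      rw [← Cardinal.mk_le_aleph0_iff, ← Module.Free.rank_eq_card_chooseBasisIndex]
      exact hU.rank_le
    exact Set.countable_range _
  -- Adding 0 makes the set nonempty, so that it is the range of a sequence.
  obtain ⟨e, he⟩ := (hb.insert 0).exists_eq_range (Set.insert_nonempty _ _)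
  let F : ℕ → Submodule ℝ U := fun n => Submodule.span ℝ (⋃ i : Fin n, Set.range fun g => ρ g (e i))
  have hF : Monotone F := by
    intro m n h
    refine Submodule.span_mono (Set.iUnion_subset fun i => ?_)
    exact Set.subset_iUnion (fun i : Fin n => Set.range fun g => ρ g (e i)) (Fin.castLE h i)
  have hfin : ∀ n, FiniteDimensional ℝ (F n) := fun n =>
    FiniteDimensional.span_of_finite ℝ (Set.finite_iUnion fun i => Set.finite_range _)
  have htop : ∀ x : U, ∃ n, x ∈ F n := by
    intro x
    have hx : x ∈ Submodule.span ℝ (Set.range b) := by simp [b.span_eq]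
    induction hx using Submodule.span_induction with
    | mem x hx =>
      obtain ⟨i, hi⟩ : x ∈ Set.range e := he ▸ Set.mem_insert_of_mem _ hx
      refine ⟨i + 1, Submodule.subset_span (Set.mem_iUnion.2 ⟨Fin.last i, 1, ?_⟩)⟩
      simp [hi]
    | zero => exact ⟨0, zero_mem _⟩
    | add x y _ _ hx hy =>
      obtain ⟨m, hm⟩ := hx
      obtain ⟨n, hn⟩ := hy
      exact ⟨max m n, add_mem (hF (le_max_left _ _) hm) (hF (le_max_right _ _) hn)⟩
    | smul c x _ hx =>
      obtain ⟨n, hn⟩ := hx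
      exact ⟨n, Submodule.smul_mem _ _ hn⟩
  refine ⟨F, hF, by simp [F], hfin, fun n g v hv => ?_, fun V hV => ?_⟩
  · induction hv using Submodule.span_induction with
    | mem x hx =>
      obtain ⟨i, h, rfl⟩ := Set.mem_iUnion.1 hx
      exact Submodule.subset_span (Set.mem_iUnion.2 ⟨i, g * h, by simp⟩)
    | zero => simp
    | add x y _ _ hx hy => rw [map_add]; exact add_mem hx hy
    | smul c x _ hx => rw [map_smul]; exact Submodule.smul_mem _ _ hx
  · obtain ⟨s, rfl⟩ := (Submodule.fg_iff_finiteDimensional V).2 hV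
    choose N hN using htop
    refine ⟨s.sup N, Submodule.span_le.2 fun x hx => hF (Finset.le_sup hx) (hN x)⟩

end Copies

/-! ### Isometries assembled from a filtration -/

section Filtration

variable {G : Type v} [Group G] {U : Type u} [NormedAddCommGroup U] [InnerProductSpace ℝ U]

/-- The projection to the orthogonal complement of `F n` in `F (n + 1)`. -/
noncomputable def gradedProjection (F : ℕ → Submodule ℝ U) [∀ n, FiniteDimensional ℝ (F n)]
    (n : ℕ) : U →L[ℝ] U :=
  (F (n + 1)).starProjection - (F n).starProjection

variable {F : ℕ → Submodule ℝ U} [∀ n, FiniteDimensional ℝ (F n)]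

theorem gradedProjection_mem (hF : Monotone F) (n : ℕ) (x : U) :
    gradedProjection F n x ∈ F (n + 1) :=
  sub_mem (Submodule.starProjection_apply_mem _ _)
    (hF n.le_succ (Submodule.starProjection_apply_mem _ _))

theorem inner_gradedProjection_of_mem (hF : Monotone F) (n : ℕ) (x : U) {y : U} (hy : y ∈ F n) :
    ⟪gradedProjection F n x, y⟫ = 0 := by
  have h1 := Submodule.starProjection_inner_eq_zero (K := F n) x y hy
  have h2 := Submodule.starProjection_inner_eq_zero (K := F (n + 1)) x y (hF n.le_succ hy)
  rw [inner_sub_left] at h1 h2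
  rw [gradedProjection, sub_apply, inner_sub_left]
  linarith

theorem inner_gradedProjection (hF : Monotone F) {m n : ℕ} (h : m ≠ n) (x y : U) :
    ⟪gradedProjection F m x, gradedProjection F n y⟫ = 0 := by
  rcases h.lt_or_gt with h | h
  · rw [real_inner_comm]
    exact inner_gradedProjection_of_mem hF n y (hF h (gradedProjection_mem hF m x))
  · exact inner_gradedProjection_of_mem hF m x (hF h (gradedProjection_mem hF n y))

theorem gradedProjection_eq_zero (hF : Monotone F) {n : ℕ} {x : U} (hx : x ∈ F n) :
    gradedProjection F n x = 0 := by
  rw [gradedProjection, sub_apply,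
    Submodule.starProjection_eq_self_iff.2 (hF n.le_succ hx),
    Submodule.starProjection_eq_self_iff.2 hx, sub_self]

/-- The sum telescopes, and the term at 0 vanishes because `F 0 = ⊥`. -/
theorem sum_gradedProjection (h0 : F 0 = ⊥) {N : ℕ} {x : U} (hx : x ∈ F N) :
    ∑ n ∈ Finset.range N, gradedProjection F n x = x := by
  simp only [gradedProjection, sub_apply]
  rw [Finset.sum_range_sub (fun n => (F n).starProjection x) N,
    Submodule.starProjection_eq_self_iff.2 hx, sub_eq_self]
  exact (Submodule.mem_bot ℝ).1 (h0.le (Submodule.starProjection_apply_mem (F 0) x))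

/-- The residual of `x` stays orthogonal to `V` under `ρ g`, as `ρ g⁻¹` preserves `V`; uniqueness of
the projection concludes. -/
theorem starProjection_equivariant {ρ : G →* (U ≃ₗᵢ[ℝ] U)} (V : Submodule ℝ U)
    [FiniteDimensional ℝ V] (hV : ∀ g, ∀ v ∈ V, ρ g v ∈ V) (g : G) (x : U) :
    V.starProjection (ρ g x) = ρ g (V.starProjection x) := by
  refine Submodule.eq_starProjection_of_mem_of_inner_eq_zero
    (hV g _ (Submodule.starProjection_apply_mem _ _)) fun w hw => ?_
  have h := Submodule.starProjection_inner_eq_zero (K := V) x _ (hV g⁻¹ w hw)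
  rw [← (ρ g).inner_map_map] at h
  simpa using h

theorem gradedProjection_equivariant {ρ : G →* (U ≃ₗᵢ[ℝ] U)}
    (hρ : ∀ n g, ∀ v ∈ F n, ρ g v ∈ F n) (n : ℕ) (g : G) (x : U) :
    gradedProjection F n (ρ g x) = ρ g (gradedProjection F n x) := by
  simp only [gradedProjection, sub_apply,
    starProjection_equivariant _ (hρ _), map_sub]

/-- The isometry of `U` whose restriction to each graded piece of the filtration is given. -/
theorem exists_isometry_of_graded (hF : Monotone F) (h0 : F 0 = ⊥) (htop : ∀ x, ∃ n, x ∈ F n)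
    (Q : ℕ → (U →L[ℝ] U))
    (hQ : ∀ n x y, ⟪Q n x, Q n y⟫ = ⟪gradedProjection F n x, gradedProjection F n y⟫)
    (hQ' : ∀ m n, m < n → ∀ x y, ⟪Q m x, Q n y⟫ = 0) :
    ∃ J : U →ₗᵢ[ℝ] U, ∀ N, ∀ x ∈ F N, J x = ∑ n ∈ Finset.range N, Q n x := by
  have hQ'' : ∀ m n, m ≠ n → ∀ x y, ⟪Q m x, Q n y⟫ = 0 := fun m n h x y => by
    rcases h.lt_or_gt with h | h
    · exact hQ' _ _ h _ _
    · rw [real_inner_comm]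
      exact hQ' _ _ h _ _
  -- The sums of the `Q n x` are therefore eventually stationary, and the isometry is well defined.
  have hzero : ∀ n, ∀ x ∈ F n, Q n x = 0 := fun n x hx => by
    rw [← inner_self_eq_zero (𝕜 := ℝ), hQ, gradedProjection_eq_zero hF hx, inner_zero_left]
  choose N hN using htop
  have key : ∀ (x : U) (m : ℕ), x ∈ F m →
      ∑ n ∈ Finset.range (N x), Q n x = ∑ n ∈ Finset.range m, Q n x := by
    have aux : ∀ (x : U) (k m : ℕ), x ∈ F k → k ≤ m →
        ∑ n ∈ Finset.range k, Q n x = ∑ n ∈ Finset.range m, Q n x := fun x k m hk hkm =>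
      Finset.sum_subset (Finset.range_mono hkm) fun n _ hn =>
        hzero n x (hF (by simpa using hn) hk)
    intro x m hm
    rcases le_total (N x) m with h | h
    · exact aux x _ _ (hN x) h
    · exact (aux x _ _ hm h).symm
  refine ⟨LinearMap.isometryOfInner
    { toFun := fun x => ∑ n ∈ Finset.range (N x), Q n x
      map_add' := fun x y => ?_
      map_smul' := fun c x => ?_ } fun x y => ?_, fun m x hx => key x m hx⟩
  · have hx := hF (le_max_left (N x) (N y)) (hN x)
    have hy := hF (le_max_right (N x) (N y)) (hN y)
    rw [key x _ hx, key y _ hy, key _ _ (add_mem hx hy), ← Finset.sum_add_distrib]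
    simp
  · rw [key _ _ (Submodule.smul_mem _ c (hN x)), RingHom.id_apply, Finset.smul_sum]
    simp
  · obtain ⟨M, hx, hy⟩ : ∃ M, x ∈ F M ∧ y ∈ F M :=
      ⟨_, hF (le_max_left (N x) (N y)) (hN x), hF (le_max_right (N x) (N y)) (hN y)⟩
    change ⟪∑ n ∈ Finset.range (N x), Q n x, ∑ n ∈ Finset.range (N y), Q n y⟫ = ⟪x, y⟫
    rw [key x _ hx, key y _ hy]
    conv_rhs => rw [← sum_gradedProjection h0 hx, ← sum_gradedProjection h0 hy]
    simp only [sum_inner, inner_sum]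
    refine Finset.sum_congr rfl fun n _ => Finset.sum_congr rfl fun m _ => ?_
    by_cases h : n = m
    · rw [h, hQ]
    · rw [hQ'' m n (Ne.symm h), inner_gradedProjection hF (Ne.symm h)]

variable {ρ : G →* (U ≃ₗᵢ[ℝ] U)}

/-- Pairwise orthogonal equivariant copies of the graded pieces of the filtration, where each piece
occurs three times, and each copy is also orthogonal to an initial part of the filtration. -/
theorem IsCompleteUniverse.exists_graded_copies (hU : IsCompleteUniverse ρ) (hF : Monotone F)
    (hρ : ∀ n g, ∀ v ∈ F n, ρ g v ∈ F n) :
    ∃ T : ℕ → (U →L[ℝ] U), (∀ m g x, T m (ρ g x) = ρ g (T m x)) ∧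
      (∀ m x y, ⟪T m x, T m y⟫ = ⟪gradedProjection F (m / 3) x, gradedProjection F (m / 3) y⟫) ∧
      (∀ k m, k ≠ m → ∀ x y, ⟪T k x, T m y⟫ = 0) ∧
      (∀ m, ∀ x ∈ F (m + 1), ∀ y, ⟪x, T m y⟫ = 0) ∧
      ∀ m, ∃ K : Submodule ℝ U, FiniteDimensional ℝ K ∧ ∀ x, T m x ∈ K := by
  -- `K` will hold the images of all earlier copies and `L` enlarges it by the new one. The index `m
  -- / 3` makes each piece appear three times.
  have step : ∀ (m : ℕ) (K : {K : Submodule ℝ U // FiniteDimensional ℝ K}),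
      ∃ T : U →L[ℝ] U, (∀ g x, T (ρ g x) = ρ g (T x)) ∧
        (∀ x y, ⟪T x, T y⟫ = ⟪gradedProjection F (m / 3) x, gradedProjection F (m / 3) y⟫) ∧
        (∀ x, ∀ k ∈ K.1 ⊔ F (m + 1), ⟪k, T x⟫ = 0) ∧
        ∃ L : {K : Submodule ℝ U // FiniteDimensional ℝ K}, K.1 ≤ L.1 ∧ ∀ x, T x ∈ L.1 := by
    rintro m ⟨K, hK⟩
    obtain ⟨j, hj, hj'⟩ := hU.exists_copy_orthogonal
      (subrepresentation ρ (F (m / 3 + 1)) (hρ _)) (K ⊔ F (m + 1))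
    let P : U →L[ℝ] F (m / 3 + 1) :=
      (gradedProjection F (m / 3)).codRestrict _ (gradedProjection_mem hF _)
    refine ⟨j.toContinuousLinearMap.comp P, fun g x => ?_, fun x y => ?_, fun x k hk => ?_,
      ⟨K ⊔ LinearMap.range j.toLinearMap, inferInstance⟩, le_sup_left, fun x => ?_⟩
    · have : P (ρ g x) = subrepresentation ρ (F (m / 3 + 1)) (hρ _) g (P x) :=
        Subtype.ext (gradedProjection_equivariant hρ _ g x)
      change j (P (ρ g x)) = ρ g (j (P x))
      rw [this, hj]
    · exact j.inner_map_map _ _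
    · exact hj' _ k hk
    · exact le_sup_right (a := K) (LinearMap.mem_range_self _ _)
  choose T hT₁ hT₂ hT₃ L hL₁ hL₂ using step
  let K : ℕ → {K : Submodule ℝ U // FiniteDimensional ℝ K} := fun n =>
    Nat.rec ⟨⊥, inferInstance⟩ L n
  have hK : Monotone fun n => (K n).1 := monotone_nat_of_le_succ fun n => hL₁ n (K n)
  have horth : ∀ k m, k < m → ∀ x y, ⟪T k (K k) x, T m (K m) y⟫ = 0 := fun k m h x y =>
    hT₃ m (K m) y _ (le_sup_left (b := F (m + 1)) (hK (Nat.succ_le_of_lt h) (hL₂ k (K k) x)))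
  refine ⟨fun m => T m (K m), fun m => hT₁ m _, fun m => hT₂ m _, fun k m h x y => ?_,
    fun m x hx y => hT₃ m _ y x (le_sup_right (a := (K m).1) hx),
    fun m => ⟨_, (L m (K m)).2, hL₂ m _⟩⟩
  rcases h.lt_or_gt with h | h
  · exact horth _ _ h _ _
  · rw [real_inner_comm]
    exact horth _ _ h _ _

end Filtration

/-! ### The deformation of a complete universe -/

section Deformation

/-- A smooth function on the line that is `0` on `(-∞, 0]` and `π / 2` on `[1, ∞)`. -/
noncomputable def quarterTurn (x : ℝ) : ℝ :=
  Real.pi / 2 * Real.smoothTransition x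

theorem contDiff_quarterTurn : ContDiff ℝ ∞ quarterTurn :=
  contDiff_const.mul Real.smoothTransition.contDiff

theorem quarterTurn_of_nonpos {x : ℝ} (h : x ≤ 0) : quarterTurn x = 0 := by
  simp [quarterTurn, Real.smoothTransition.zero_of_nonpos h]

theorem quarterTurn_of_one_le {x : ℝ} (h : 1 ≤ x) : quarterTurn x = Real.pi / 2 := by
  simp [quarterTurn, Real.smoothTransition.one_of_one_le h]

/-- The angle by which the `n`-th graded piece is turned at time `s`: the turn happens for
`1 / (n + 2) ≤ 2 * s ≤ 1 / (n + 1)`. -/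
noncomputable def pieceAngle (n : ℕ) (s : ℝ) : ℝ :=
  quarterTurn (((n : ℝ) + 1) * (((n : ℝ) + 2) * (2 * s) - 1))

theorem contDiff_pieceAngle (n : ℕ) : ContDiff ℝ ∞ (pieceAngle n) :=
  contDiff_quarterTurn.comp (by fun_prop)

theorem pieceAngle_zero (n : ℕ) : pieceAngle n 0 = 0 :=
  quarterTurn_of_nonpos (by
    have : (0 : ℝ) ≤ n := n.cast_nonneg
    linarith)

theorem pieceAngle_of_half_le (n : ℕ) {s : ℝ} (hs : 1 / 2 ≤ s) : pieceAngle n s = Real.pi / 2 :=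
  quarterTurn_of_one_le (by
    have : (0 : ℝ) ≤ n := n.cast_nonneg
    nlinarith [mul_nonneg this this])

/-- Later pieces turn first: either piece `k` has not started, or `2 * s > 1 / (k + 2) ≥ 1 / (l +
1)` and piece `l` has finished. -/
theorem sin_pieceAngle_mul_cos_pieceAngle {k l : ℕ} (h : k < l) (s : ℝ) :
    Real.sin (pieceAngle k s) * Real.cos (pieceAngle l s) = 0 := by
  rcases le_or_gt (((k : ℝ) + 2) * (2 * s) - 1) 0 with hs | hs
  · rw [pieceAngle, quarterTurn_of_nonpos (mul_nonpos_of_nonneg_of_nonpos (by positivity) hs),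
      Real.sin_zero, zero_mul]
  · have hkl : (k : ℝ) + 1 ≤ l := by exact_mod_cast h
    have hs0 : 0 < s := by
      by_contra! hs0
      have : (0 : ℝ) ≤ (k : ℝ) + 2 := by positivity
      nlinarith
    have h1 : 1 ≤ ((l : ℝ) + 1) * (2 * s) := by nlinarith
    rw [pieceAngle, pieceAngle, quarterTurn_of_one_le (x := ((l : ℝ) + 1) * _) (by
      have : (0 : ℝ) ≤ l := l.cast_nonneg
      nlinarith), Real.cos_pi_div_two, mul_zero]

variable {G : Type v} [Group G] {U : Type u} [NormedAddCommGroup U] [InnerProductSpace ℝ U]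

/-- A smooth path of equivariant isometries of `U` that starts at the identity, and two more
equivariant isometries, such that from time `1 / 2` on all images are pairwise orthogonal. -/
structure Deformation (ρ : G →* (U ≃ₗᵢ[ℝ] U)) where
  path : ℝ → (U →ₗᵢ[ℝ] U)
  left : U →ₗᵢ[ℝ] U
  right : U →ₗᵢ[ℝ] U
  path_equivariant : ∀ s g u, path s (ρ g u) = ρ g (path s u)
  left_equivariant : ∀ g u, left (ρ g u) = ρ g (left u)
  right_equivariant : ∀ g u, right (ρ g u) = ρ g (right u)
  path_zero : ∀ u, path 0 u = u
  inner_path_left : ∀ s, 1 / 2 ≤ s → ∀ u v, ⟪path s u, left v⟫ = 0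
  inner_path_right : ∀ s, 1 / 2 ≤ s → ∀ u v, ⟪path s u, right v⟫ = 0
  inner_left_right : ∀ u v, ⟪left u, right v⟫ = 0
  smooth : ∀ V : Submodule ℝ U, FiniteDimensional ℝ V → ∃ Φ : ℝ × U → U, ContDiff ℝ ∞ Φ ∧
    (∀ s, ∀ v ∈ V, Φ (s, v) = path s v) ∧
    ∃ W : Submodule ℝ U, FiniteDimensional ℝ W ∧ ∀ s, ∀ v ∈ V, path s v ∈ W

theorem IsCompleteUniverse.nonempty_deformation [Finite G] {ρ : G →* (U ≃ₗᵢ[ℝ] U)}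
    (hU : IsCompleteUniverse ρ) : Nonempty (Deformation ρ) := by
  obtain ⟨F, hF, h0, hfin, hρ, hV⟩ := hU.exists_filtration
  have htop : ∀ x, ∃ n, x ∈ F n := fun x => by
    obtain ⟨n, hn⟩ := hV (Submodule.span ℝ {x}) inferInstance
    exact ⟨n, hn (Submodule.mem_span_singleton_self x)⟩
  obtain ⟨T, hT, hTT, horth, hFT, hK⟩ := hU.exists_graded_copies hF hρ
  have hTT' : ∀ i < 3, ∀ n x y, ⟪T (3 * n + i) x, T (3 * n + i) y⟫ =
      ⟪gradedProjection F n x, gradedProjection F n y⟫ := fun i hi n x y => by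
    rw [hTT, show (3 * n + i) / 3 = n by omega]
  -- This holds because `F (m + 1) ≤ F (3 * n + 1)`. It can fail for `m > n`, which is why the
  -- turning times are staggered.
  have hPT : ∀ m n, m ≤ n → ∀ x y, ⟪gradedProjection F m x, T (3 * n) y⟫ = 0 :=
    fun m n h x y => hFT _ _ (hF (by omega) (gradedProjection_mem hF m x)) y
  let Q : ℝ → ℕ → (U →L[ℝ] U) := fun s n =>
    Real.cos (pieceAngle n s) • gradedProjection F n + Real.sin (pieceAngle n s) • T (3 * n)
  have hQ : ∀ s n x, Q s n x = Real.cos (pieceAngle n s) • gradedProjection F n x +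
      Real.sin (pieceAngle n s) • T (3 * n) x := fun s n x => rfl
  have hpath : ∀ s, ∃ J : U →ₗᵢ[ℝ] U, ∀ N, ∀ x ∈ F N,
      J x = ∑ n ∈ Finset.range N, Q s n x := by
    intro s
    refine exists_isometry_of_graded hF h0 htop (Q s) (fun n x y => ?_) (fun m n h x y => ?_)
    · have h1 := hPT n n le_rfl x y
      have h2 := hPT n n le_rfl y x
      have h3 : ⟪T (3 * n) x, T (3 * n) y⟫ = _ := hTT' 0 (by norm_num) n x y
      rw [real_inner_comm] at h2
      simp only [hQ, inner_add_left, inner_add_right, real_inner_smul_left,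
        real_inner_smul_right, h1, h2, h3]
      linear_combination ⟪gradedProjection F n x, gradedProjection F n y⟫ *
        Real.cos_sq_add_sin_sq (pieceAngle n s)
    · have h1 := hPT m n h.le x y
      have h2 := inner_gradedProjection hF h.ne x y
      have h3 := horth (3 * m) (3 * n) (by omega) x y
      simp only [hQ, inner_add_left, inner_add_right, real_inner_smul_left,
        real_inner_smul_right, h1, h2, h3]
      -- The one cross term without geometric reason to vanish has coefficient `sin * cos`, which
      -- the order of the turns makes zero.
      linear_combination ⟪T (3 * m) x, gradedProjection F n y⟫ *
        sin_pieceAngle_mul_cos_pieceAngle h s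
  choose A hA using hpath
  obtain ⟨B, hB⟩ := exists_isometry_of_graded hF h0 htop (fun n => T (3 * n + 1))
    (hTT' 1 (by norm_num)) (fun m n h => horth _ _ (by omega))
  obtain ⟨C, hC⟩ := exists_isometry_of_graded hF h0 htop (fun n => T (3 * n + 2))
    (hTT' 2 (by norm_num)) (fun m n h => horth _ _ (by omega))
  have hQend : ∀ s, 1 / 2 ≤ s → ∀ n x, Q s n x = T (3 * n) x := fun s hs n x => by
    simp [hQ, pieceAngle_of_half_le n hs]
  have hQρ : ∀ s n g x, Q s n (ρ g x) = ρ g (Q s n x) := fun s n g x => by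
    simp only [hQ, gradedProjection_equivariant hρ, hT, map_add, map_smul]
  refine ⟨⟨A, B, C, fun s g u => ?_, fun g u => ?_, fun g u => ?_, fun u => ?_, fun s hs u v => ?_,
    fun s hs u v => ?_, fun u v => ?_, fun V hVfin => ?_⟩⟩
  · obtain ⟨N, hN⟩ := htop u
    simp only [hA s N _ hN, hA s N _ (hρ N g _ hN), hQρ, map_sum]
  · obtain ⟨N, hN⟩ := htop u
    simp only [hB N _ hN, hB N _ (hρ N g _ hN), hT, map_sum]
  · obtain ⟨N, hN⟩ := htop u
    simp only [hC N _ hN, hC N _ (hρ N g _ hN), hT, map_sum]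
  · obtain ⟨N, hN⟩ := htop u
    simp only [hA 0 N _ hN, hQ, pieceAngle_zero, Real.cos_zero, Real.sin_zero, one_smul, zero_smul,
      add_zero, sum_gradedProjection h0 hN]
  · obtain ⟨M, hM⟩ := htop u
    obtain ⟨N, hN⟩ := htop v
    simp only [hA s M _ hM, hB N _ hN, hQend s hs, sum_inner, inner_sum]
    exact Finset.sum_eq_zero fun n _ => Finset.sum_eq_zero fun m _ => horth _ _ (by omega) _ _
  · obtain ⟨M, hM⟩ := htop u
    obtain ⟨N, hN⟩ := htop v
    simp only [hA s M _ hM, hC N _ hN, hQend s hs, sum_inner, inner_sum]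
    exact Finset.sum_eq_zero fun n _ => Finset.sum_eq_zero fun m _ => horth _ _ (by omega) _ _
  · obtain ⟨M, hM⟩ := htop u
    obtain ⟨N, hN⟩ := htop v
    simp only [hB M _ hM, hC N _ hN, sum_inner, inner_sum]
    exact Finset.sum_eq_zero fun n _ => Finset.sum_eq_zero fun m _ => horth _ _ (by omega) _ _
  · obtain ⟨N, hN⟩ := hV V hVfin
    choose K hKfin hTK using hK
    -- On `F N` the path is this finite sum, which is smooth in time and vector on all of `ℝ × U`.
    refine ⟨fun z => ∑ n ∈ Finset.range N, Q z.1 n z.2, ?_, fun s v hv => (hA s N v (hN hv)).symm,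
      F N ⊔ ⨆ n : Fin N, K (3 * n), inferInstance, fun s v hv => ?_⟩
    · refine ContDiff.sum fun n _ => ?_
      simp only [hQ]
      have := contDiff_pieceAngle n
      exact ((Real.contDiff_cos.comp (this.comp contDiff_fst)).smul
        ((gradedProjection F n).contDiff.comp contDiff_snd)).add
        ((Real.contDiff_sin.comp (this.comp contDiff_fst)).smul
          ((T (3 * n)).contDiff.comp contDiff_snd))
    · rw [hA s N v (hN hv)]
      refine sum_mem fun n hn => ?_
      rw [Finset.mem_range] at hn
      rw [hQ]
      refine add_mem (Submodule.smul_mem _ _ (le_sup_left (b := ⨆ n : Fin N, K (3 * n))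
        (hF hn (gradedProjection_mem hF n v)))) (Submodule.smul_mem _ _ ?_)
      exact le_sup_right (a := F N) (le_iSup (fun n : Fin N => K (3 * n)) ⟨n, hn⟩ (hTK _ v))

end Deformation

/-! ### Pushing families along a deformation -/

namespace Deformation

variable {G : Type v} [Group G] {U : Type u} [NormedAddCommGroup U] [InnerProductSpace ℝ U]
  {ρ : G →* (U ≃ₗᵢ[ℝ] U)}

/-- The coefficient of the moved vector: `1` until time `1 / 2`, and `0` at time `1`. -/
noncomputable def coeff (s : ℝ) : ℝ := Real.cos (quarterTurn (2 * s - 1))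

/-- The coefficient of the constant vector: `0` until time `1 / 2`, and `1` at time `1`. -/
noncomputable def coeff' (s : ℝ) : ℝ := Real.sin (quarterTurn (2 * s - 1))

theorem contDiff_coeff : ContDiff ℝ ∞ coeff :=
  Real.contDiff_cos.comp (contDiff_quarterTurn.comp (by fun_prop))

theorem contDiff_coeff' : ContDiff ℝ ∞ coeff' :=
  Real.contDiff_sin.comp (contDiff_quarterTurn.comp (by fun_prop))

theorem coeff_sq_add_sq (s : ℝ) : coeff s ^ 2 + coeff' s ^ 2 = 1 :=
  Real.cos_sq_add_sin_sq _

@[simp] theorem coeff_zero : coeff 0 = 1 := by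
  simp [coeff, quarterTurn_of_nonpos]

@[simp] theorem coeff'_zero : coeff' 0 = 0 := by
  simp [coeff', quarterTurn_of_nonpos]

@[simp] theorem coeff_one : coeff 1 = 0 := by
  rw [coeff, quarterTurn_of_one_le (by norm_num), Real.cos_pi_div_two]

@[simp] theorem coeff'_one : coeff' 1 = 1 := by
  rw [coeff', quarterTurn_of_one_le (by norm_num), Real.sin_pi_div_two]

theorem half_le_of_coeff'_ne_zero {s : ℝ} (h : coeff' s ≠ 0) : 1 / 2 ≤ s := by
  by_contra! hs
  exact h (by rw [coeff', quarterTurn_of_nonpos (by linarith), Real.sin_zero])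

theorem coeff_ne_zero_of_coeff'_eq_zero {s : ℝ} (h : coeff' s = 0) : coeff s ≠ 0 := by
  intro h'
  simpa [h, h'] using coeff_sq_add_sq s

variable (D : Deformation ρ)

/-- The isometry `f`, moved along the deformation from `f` to `D.right`. -/
noncomputable def push (s : ℝ) (f : U →ₗᵢ[ℝ] U) : U →ₗᵢ[ℝ] U :=
  LinearMap.isometryOfInner
    (coeff s • ((D.path s).comp f).toLinearMap + coeff' s • D.right.toLinearMap) fun u v => by
      simp only [LinearMap.add_apply, LinearMap.smul_apply, LinearIsometry.coe_toLinearMap,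
        inner_add_left, inner_add_right, real_inner_smul_left, real_inner_smul_right,
        LinearIsometry.inner_map_map]
      -- Before the second summand appears, no orthogonality is available, but none is needed.
      by_cases h : coeff' s = 0
      · have := coeff_sq_add_sq s
        rw [h] at this ⊢
        linear_combination ⟪u, v⟫ * this
      · have h1 := D.inner_path_right s (half_le_of_coeff'_ne_zero h) (f u) v
        have h2 := D.inner_path_right s (half_le_of_coeff'_ne_zero h) (f v) u
        rw [real_inner_comm] at h2
        rw [LinearIsometry.coe_comp, Function.comp_apply, Function.comp_apply, h1, h2]
        linear_combination ⟪u, v⟫ * coeff_sq_add_sq s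

theorem push_apply (s : ℝ) (f : U →ₗᵢ[ℝ] U) (u : U) :
    D.push s f u = coeff s • D.path s (f u) + coeff' s • D.right u := rfl

/-- The two path terms are orthogonal because the path is isometric, and `left` is orthogonal to
`right` at all times. The mixed terms carry a factor `coeff' s`, which is nonzero only once the path
has become orthogonal to both. -/
theorem inner_push (s : ℝ) (f : U →ₗᵢ[ℝ] U) {w : U} (hw : ∀ u, ⟪f u, w⟫ = 0) (u w' : U) :
    ⟪D.push s f u, coeff s • D.path s w + coeff' s • D.left w'⟫ = 0 := by
  simp only [push_apply, inner_add_left, inner_add_right, real_inner_smul_left,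
    real_inner_smul_right, LinearIsometry.inner_map_map, hw]
  have h3 := D.inner_left_right w' u
  rw [real_inner_comm] at h3
  by_cases h : coeff' s = 0
  · simp [h]
  · have h1 := D.inner_path_left s (half_le_of_coeff'_ne_zero h) (f u) w'
    have h2 := D.inner_path_right s (half_le_of_coeff'_ne_zero h) w u
    rw [real_inner_comm] at h2
    simp [h1, h2, h3]

theorem exists_finiteDimensional (V V' : Submodule ℝ U) [hV : FiniteDimensional ℝ V]
    [FiniteDimensional ℝ V'] : ∃ W : Submodule ℝ U, FiniteDimensional ℝ W ∧
      ∀ s, ∀ v ∈ V, ∀ v' ∈ V', coeff s • D.path s v + coeff' s • v' ∈ W := by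
  obtain ⟨-, -, -, W, hW, h⟩ := D.smooth V hV
  exact ⟨W ⊔ V', inferInstance, fun s v hv v' hv' => Submodule.add_mem_sup
    (Submodule.smul_mem _ _ (h s v hv)) (Submodule.smul_mem _ _ hv')⟩

theorem isSmoothFamily {E : Type*} [NormedAddCommGroup E] [NormedSpace ℝ E] {H : Type*}
    [TopologicalSpace H] {I : ModelWithCorners ℝ E H} {X : Type*} [TopologicalSpace X]
    [ChartedSpace H X] {p : ℕ} {f : X → Simplex p → U}
    (hf : IsSmoothFamily I (modelWithCornersSelf ℝ U) f) (W : Submodule ℝ U)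
    [hW : FiniteDimensional ℝ W] (hfW : ∀ x t, f x t ∈ W) {g : X → U}
    (hg : ContMDiff I (modelWithCornersSelf ℝ U) ∞ g) (α : Fin (p + 1) → Fin 2) :
    IsSmoothFamily I (modelWithCornersSelf ℝ U) fun x t =>
      coeff (intervalCoord α t) • D.path (intervalCoord α t) (f x t) +
        coeff' (intervalCoord α t) • g x := by
  obtain ⟨F, hF, hFf⟩ := hf
  obtain ⟨Φ, hΦ, hΦW, -⟩ := D.smooth W hW
  -- The time is extended linearly to the ambient space. `Φ` agrees with the path only on `W`, which
  -- suffices since `f` takes values there.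
  let τ : (Fin (p + 1) → ℝ) → ℝ := fun t => ∑ i with α i = 1, t i
  have hτ' : ContDiff ℝ ∞ τ := ContDiff.sum fun i _ => contDiff_apply ℝ ℝ i
  have hτ : ContMDiff (I.prod (modelWithCornersSelf ℝ (Fin (p + 1) → ℝ)))
      (modelWithCornersSelf ℝ ℝ) ∞ (fun z : X × (Fin (p + 1) → ℝ) => τ z.2) :=
    hτ'.contMDiff.comp contMDiff_snd
  refine ⟨fun z => coeff (τ z.2) • Φ (τ z.2, F z) + coeff' (τ z.2) • g z.1, ?_, fun x t => ?_⟩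
  · exact ((contDiff_coeff.contMDiff.comp hτ).contMDiffOn.smul
      (hΦ.contMDiff.comp_contMDiffOn (hτ.contMDiffOn.prodMk_space hF))).add
      ((contDiff_coeff'.contMDiff.comp hτ).contMDiffOn.smul
        (hg.comp contMDiff_fst).contMDiffOn)
  · have : τ t.1 = intervalCoord α t := (intervalCoord_eq_sum α t).symm
    simp only [this, hFf, hΦW _ _ (hfW x t)]

end Deformation

/-! ### Contracting the space of isometries -/

section Contractible

variable {G : Type v} [Group G] {U : Type u} [NormedAddCommGroup U] [InnerProductSpace ℝ U]
  {ρ : G →* (U ≃ₗᵢ[ℝ] U)}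

/-- The constant family of isometries. -/
noncomputable def IsometrySimplex.const (f : U →ₗᵢ[ℝ] U) (hf : ∀ g u, f (ρ g u) = ρ g (f u))
    (p : ℕ) : IsometrySimplex ρ p where
  toFun _ := f
  equivariant _ := hf
  smooth V _ := by
    refine ⟨⟨fun z => f z.1, ?_, fun _ _ => rfl⟩, V.map f.toLinearMap, inferInstance,
      fun _ v hv => Submodule.mem_map_of_mem hv⟩
    exact ((f.toContinuousLinearMap.comp V.subtypeL).contMDiff.comp contMDiff_fst).contMDiffOn

/-- The simplex `σ`, moved along a deformation, with time a given map from the simplex to the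
interval. -/
noncomputable def IsometrySimplex.push (D : Deformation ρ) {p : ℕ} (σ : IsometrySimplex ρ p)
    (α : Fin (p + 1) → Fin 2) : IsometrySimplex ρ p where
  toFun t := D.push (intervalCoord α t) (σ.toFun t)
  equivariant t g u := by
    simp only [D.push_apply, σ.equivariant, D.path_equivariant, D.right_equivariant, map_add,
      map_smul]
  smooth V hV := by
    obtain ⟨h, W, hW, hVW⟩ := σ.smooth V hV
    refine ⟨D.isSmoothFamily h W (fun v t => hVW t v v.2) (g := fun v : V => D.right v) ?_ α, ?_⟩
    · exact (D.right.toContinuousLinearMap.comp V.subtypeL).contMDiff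
    · obtain ⟨W', hW', h'⟩ := D.exists_finiteDimensional W (V.map D.right.toLinearMap)
      exact ⟨W', hW', fun t v hv => h' _ _ (hVW t v hv) _ (Submodule.mem_map_of_mem hv)⟩

theorem IsometrySimplex.push_reindex (D : Deformation ρ) {p q : ℕ} (σ : IsometrySimplex ρ p)
    (α : Fin (p + 1) → Fin 2) (θ : Fin (q + 1) → Fin (p + 1)) :
    (σ.reindex θ).push D (α ∘ θ) = (σ.push D α).reindex θ := by
  ext t v
  change D.push (intervalCoord (α ∘ θ) t) _ v = _
  rw [intervalCoord_comp]
  rfl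

theorem IsometrySimplex.push_zero (D : Deformation ρ) {p : ℕ} (σ : IsometrySimplex ρ p) :
    σ.push D (fun _ => 0) = σ := by
  ext t v
  change D.push (intervalCoord (fun _ => 0) t) _ v = _
  simp [D.push_apply, D.path_zero]

theorem IsometrySimplex.push_one (D : Deformation ρ) {p : ℕ} (σ : IsometrySimplex ρ p) :
    σ.push D (fun _ => 1) = .const D.right D.right_equivariant p := by
  ext t v
  change D.push (intervalCoord (fun _ => 1) t) _ v = D.right v
  simp [D.push_apply]

/-- The constant map to `L(U, U)`. -/
noncomputable def constL (X : SSet.{u}) (f : U →ₗᵢ[ℝ] U) (hf : ∀ g u, f (ρ g u) = ρ g (f u)) :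
    X ⟶ L ρ where
  app n := ↾fun _ => IsometrySimplex.const f hf n.unop.len
  naturality _ _ _ := rfl

theorem Deformation.isContractible_L (D : Deformation ρ) : IsContractible (L ρ) := by
  refine IsWeakEquivalence.of_section (constL _ D.right D.right_equivariant)
    (Limits.terminalIsTerminal.hom_ext _ _) ?_
  exact HomotopyRel.of_family (fun n σ α => IsometrySimplex.push D σ α)
    (fun n m θ σ α => IsometrySimplex.push_reindex D σ α _)
    (fun n σ => IsometrySimplex.push_zero D σ) (fun n σ => IsometrySimplex.push_one D σ)

end Contractible

/-! ### Equivariant embeddings into a universe -/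

section Embedding

variable {E : Type*} [NormedAddCommGroup E] [NormedSpace ℝ E] {H : Type*} [TopologicalSpace H]
  {I : ModelWithCorners ℝ E H} {X : Type*} [TopologicalSpace X] [ChartedSpace H X]

theorem mfderiv_clm_comp_apply {W W' : Type*} [NormedAddCommGroup W] [NormedSpace ℝ W]
    [NormedAddCommGroup W'] [NormedSpace ℝ W'] (A : W →L[ℝ] W') {f : X → W} {x : X}
    (hf : MDifferentiableAt I (modelWithCornersSelf ℝ W) f x) (v : TangentSpace I x) :
    mfderiv I (modelWithCornersSelf ℝ W') (fun y => A (f y)) x v =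
      A (mfderiv I (modelWithCornersSelf ℝ W) f x v) := by
  have h := (A.hasMFDerivAt (x := f x)).comp x hf.hasMFDerivAt
  have h' := h.mfderiv
  exact congrArg (fun T : E →L[ℝ] W' => T v) h'

variable {E' : Type*} [NormedAddCommGroup E'] [NormedSpace ℝ E'] {H' : Type*}
  [TopologicalSpace H'] {J : ModelWithCorners ℝ E' H'} {Y : Type*} [TopologicalSpace Y]
  [ChartedSpace H' Y] {U : Type*} [NormedAddCommGroup U] [InnerProductSpace ℝ U]

/-- If `e` is a smooth embedding or `i` is an injective immersion, then so is a combination of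
the two along isometries with orthogonal images. -/
theorem IsSmoothEmb.combine [CompactSpace X] [T2Space Y] {e₁ : X → Y} {e₂ i : X → U}
    (he₁ : ContMDiff I J ∞ e₁) (he₂ : ContMDiff I (modelWithCornersSelf ℝ U) ∞ e₂)
    (hi : ContMDiff I (modelWithCornersSelf ℝ U) ∞ i) (hi_inj : Function.Injective i)
    (hi_imm : ∀ x, Function.Injective (mfderiv I (modelWithCornersSelf ℝ U) i x))
    (A B : U →ₗᵢ[ℝ] U) (c d : ℝ) (hAB : d ≠ 0 → ∀ u w, ⟪A u, B w⟫ = 0)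
    (h : d = 0 → c ≠ 0 ∧ IsSmoothEmb I (J.prod (modelWithCornersSelf ℝ U))
      (fun x => (e₁ x, e₂ x))) :
    IsSmoothEmb I (J.prod (modelWithCornersSelf ℝ U))
      (fun x => (e₁ x, c • A (e₂ x) + d • B (i x))) := by
  -- Applied to differences of values this gives injectivity, and applied to derivatives it gives
  -- the immersion property.
  have key : ∀ u w, c • A u + d • B w = 0 → (d ≠ 0 → w = 0) ∧ (d = 0 → u = 0) := by
    intro u w huw
    refine ⟨fun hd => ?_, fun hd => ?_⟩
    · have h1 := congrArg (fun z => ⟪z, B w⟫) huw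
      simp only [inner_add_left, real_inner_smul_left, hAB hd, LinearIsometry.inner_map_map,
        inner_zero_left, mul_zero, zero_add, mul_eq_zero, hd, false_or] at h1
      exact inner_self_eq_zero.1 h1
    · rw [hd, zero_smul, add_zero, smul_eq_zero] at huw
      exact (map_eq_zero_iff A A.injective).1 (huw.resolve_left (h hd).1)
  let T : U × U →L[ℝ] U :=
    c • A.toContinuousLinearMap.comp (ContinuousLinearMap.fst ℝ U U) +
      d • B.toContinuousLinearMap.comp (ContinuousLinearMap.snd ℝ U U)
  have hT : ∀ z, T z = c • A z.1 + d • B z.2 := fun z => rfl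
  have he₂i : ContMDiff I (modelWithCornersSelf ℝ (U × U)) ∞ (fun x => (e₂ x, i x)) :=
    he₂.prodMk_space hi
  have hsmooth : ContMDiff I (modelWithCornersSelf ℝ U) ∞ (fun x => T (e₂ x, i x)) :=
    T.contMDiff.comp he₂i
  have hfull : ContMDiff I (J.prod (modelWithCornersSelf ℝ U)) ∞
      (fun x => (e₁ x, T (e₂ x, i x))) := he₁.prodMk hsmooth
  have hdiff : ∀ x (v : TangentSpace I x),
      mfderiv I (modelWithCornersSelf ℝ U) (fun x => T (e₂ x, i x)) x v =
        c • A (mfderiv I (modelWithCornersSelf ℝ U) e₂ x v) +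
          d • B (mfderiv I (modelWithCornersSelf ℝ U) i x v) := by
    intro x v
    have hA := mfderiv_clm_comp_apply (c • A.toContinuousLinearMap)
      (he₂.mdifferentiableAt (x := x) (by simp)) v
    have hB := mfderiv_clm_comp_apply (d • B.toContinuousLinearMap)
      (hi.mdifferentiableAt (x := x) (by simp)) v
    have h := mfderiv_add
      (((c • A.toContinuousLinearMap).contMDiff.comp he₂).mdifferentiableAt (x := x) (by simp))
      (((d • B.toContinuousLinearMap).contMDiff.comp hi).mdifferentiableAt (x := x) (by simp))
    exact (congrArg (fun S : E →L[ℝ] U => S v) h).trans (congrArg₂ (fun a b : U => a + b) hA hB)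
  -- Compactness of the source and the Hausdorff property of the target reduce the topological
  -- embedding to injectivity.
  refine ⟨hfull, (hfull.continuous.isClosedEmbedding fun x y hxy => ?_).isEmbedding, fun x => ?_⟩
  · obtain ⟨hxy₁, hxy₂⟩ := Prod.mk.inj hxy
    have h0 : c • A (e₂ x - e₂ y) + d • B (i x - i y) = 0 := by
      have : T ((e₂ x, i x) - (e₂ y, i y)) = 0 := by rw [map_sub, hxy₂, sub_self]
      simpa [hT] using this
    by_cases hd : d = 0
    · exact (h hd).2.isEmbedding.injective
        (Prod.ext hxy₁ (sub_eq_zero.1 ((key _ _ h0).2 hd)))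
    · exact hi_inj (sub_eq_zero.1 ((key _ _ h0).1 hd))
  · change Function.Injective (mfderiv I _ (fun x => (e₁ x, T (e₂ x, i x))) x)
    rw [mfderiv_prodMk (he₁.mdifferentiableAt (by simp)) (hsmooth.mdifferentiableAt (by simp))]
    refine (injective_iff_map_eq_zero _).2 fun v hv => ?_
    obtain ⟨hv₁, hv₂⟩ := Prod.mk.inj hv
    have h0 := (hdiff x v).symm.trans hv₂
    by_cases hd : d = 0
    · have hinj := (h hd).2.injective_mfderiv x
      rw [mfderiv_prodMk (he₁.mdifferentiableAt (by simp)) (he₂.mdifferentiableAt (by simp))]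
        at hinj
      exact (injective_iff_map_eq_zero _).1 hinj v (Prod.ext hv₁ ((key _ _ h0).2 hd))
    · exact (injective_iff_map_eq_zero _).1 (hi_imm x) v ((key _ _ h0).1 hd)

end Embedding

/-! ### An equivariant Whitney embedding -/

section EquivariantEmbedding

variable {G : Type v} [Group G] [Finite G] {U : Type u} [NormedAddCommGroup U]
  [InnerProductSpace ℝ U]

/-- The permutation representation of `G` on the functions from `G` to a Euclidean space. -/
noncomputable def coinducedRepresentation (G : Type v) [Group G] [Fintype G] (W : Type*)
    [NormedAddCommGroup W] [InnerProductSpace ℝ W] :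
    G →* (PiLp 2 (fun _ : G => W) ≃ₗᵢ[ℝ] PiLp 2 (fun _ : G => W)) where
  toFun g := LinearIsometryEquiv.piLpCongrLeft 2 ℝ W (Equiv.mulLeft g)
  map_one' := by ext f h; simp; rfl
  map_mul' a b := by ext f h; simp; rfl

/-- A compact smooth `G`-manifold has an equivariant embedding into a finite-dimensional subspace
of a complete universe. -/
theorem IsCompleteUniverse.exists_embedding {ρ : G →* (U ≃ₗᵢ[ℝ] U)} (hU : IsCompleteUniverse ρ)
    (M : GManifold.{u} G) :
    ∃ i : M → U, ContMDiff M.model (modelWithCornersSelf ℝ U) ∞ i ∧ Function.Injective i ∧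
      (∀ x, Function.Injective (mfderiv M.model (modelWithCornersSelf ℝ U) i x)) ∧
      (∀ (g : G) x, i (g • x) = ρ g (i x)) ∧
      ∃ V : Submodule ℝ U, FiniteDimensional ℝ V ∧ ∀ x, i x ∈ V := by
  have := Fintype.ofFinite G
  obtain ⟨n, e, he, he_emb, he_imm⟩ := exists_embedding_euclidean_of_compact (I := M.model) (M := M)
  obtain ⟨j, hj, -⟩ := hU.exists_copies_of_finiteDimensional
    (coinducedRepresentation G (EuclideanSpace ℝ (Fin n)))
  -- The inverse turns the action on `M` into left translation on `G`. The coordinate at 1 is `e`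
  -- itself, so `i₀` inherits injectivity on points and tangent vectors.
  let i₀ : M → PiLp 2 (fun _ : G => EuclideanSpace ℝ (Fin n)) := fun x =>
    WithLp.toLp 2 fun h => e (h⁻¹ • x)
  have hi₀ : ContMDiff M.model
      (modelWithCornersSelf ℝ (PiLp 2 (fun _ : G => EuclideanSpace ℝ (Fin n)))) ∞ i₀ := by
    have h1 : ContMDiff M.model (modelWithCornersSelf ℝ (G → EuclideanSpace ℝ (Fin n))) ∞
        (fun x (h : G) => e (h⁻¹ • x)) :=
      contMDiff_pi_space.2 fun h => he.comp (M.smooth_smul h⁻¹)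
    exact (PiLp.continuousLinearEquiv 2 ℝ
      (fun _ : G => EuclideanSpace ℝ (Fin n))).symm.toContinuousLinearMap.contMDiff.comp h1
  let P : PiLp 2 (fun _ : G => EuclideanSpace ℝ (Fin n)) →L[ℝ] EuclideanSpace ℝ (Fin n) :=
    PiLp.proj 2 _ 1
  have hP : (fun x => P (i₀ x)) = e := by
    funext x
    simp [P, i₀]
  have hi₀' : ∀ x, MDifferentiableAt M.model
      (modelWithCornersSelf ℝ (PiLp 2 (fun _ : G => EuclideanSpace ℝ (Fin n)))) i₀ x := fun x =>
    hi₀.mdifferentiableAt (by simp)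
  refine ⟨fun x => j 0 (i₀ x), (j 0).toContinuousLinearMap.contMDiff.comp hi₀, ?_, fun x => ?_,
    fun g x => ?_, LinearMap.range (j 0).toLinearMap, inferInstance, fun x => ⟨i₀ x, rfl⟩⟩
  · refine (j 0).injective.comp fun x y hxy => he_emb.injective ?_
    rw [← hP]
    exact congrArg P hxy
  · refine (injective_iff_map_eq_zero _).2 fun v hv => ?_
    have h1 := mfderiv_clm_comp_apply (j 0).toContinuousLinearMap (hi₀' x) v
    have h2 := mfderiv_clm_comp_apply P (hi₀' x) v
    have h3 : mfderiv M.model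
        (modelWithCornersSelf ℝ (PiLp 2 (fun _ : G => EuclideanSpace ℝ (Fin n)))) i₀ x v = 0 :=
      (map_eq_zero_iff (j 0) (j 0).injective).1 (h1.symm.trans hv)
    rw [hP, h3] at h2
    exact (injective_iff_map_eq_zero _).1 (he_imm x) v (h2.trans (map_zero P))
  · rw [← hj]
    refine congrArg (j 0) (PiLp.ext fun h => ?_)
    simp [i₀, coinducedRepresentation, mul_smul]

end EquivariantEmbedding

/-! ### The forgetful map to the smooth mapping space -/

section Family

variable {E : Type*} [NormedAddCommGroup E] [NormedSpace ℝ E] {H : Type*} [TopologicalSpace H]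
  {I : ModelWithCorners ℝ E H} {X : Type*} [TopologicalSpace X] [ChartedSpace H X]
  {E' : Type*} [NormedAddCommGroup E'] [NormedSpace ℝ E'] {H' : Type*} [TopologicalSpace H']
  {J : ModelWithCorners ℝ E' H'} {Y : Type*} [TopologicalSpace Y] [ChartedSpace H' Y]
  {U : Type*} [NormedAddCommGroup U] [InnerProductSpace ℝ U]

theorem IsSmoothFamily.snd {p : ℕ} {f : X → Simplex p → Y × U}
    (hf : IsSmoothFamily I (J.prod (modelWithCornersSelf ℝ U)) f) :
    IsSmoothFamily I (modelWithCornersSelf ℝ U) (fun x t => (f x t).2) := by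
  obtain ⟨F, hF, hFf⟩ := hf
  exact ⟨fun z => (F z).2, contMDiff_snd.comp_contMDiffOn hF, fun x t => congrArg Prod.snd (hFf x t)⟩

theorem IsSmoothFamily.prodMk {p : ℕ} {f : X → Simplex p → Y} {g : X → Simplex p → U}
    (hf : IsSmoothFamily I J f) (hg : IsSmoothFamily I (modelWithCornersSelf ℝ U) g) :
    IsSmoothFamily I (J.prod (modelWithCornersSelf ℝ U)) (fun x t => (f x t, g x t)) := by
  obtain ⟨F, hF, hFf⟩ := hf
  obtain ⟨F', hF', hFf'⟩ := hg
  exact ⟨fun z => (F z, F' z), hF.prodMk hF', fun x t => Prod.ext (hFf x t) (hFf' x t)⟩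

theorem IsSmoothFamily.contMDiff {p : ℕ} {f : X → Simplex p → Y} (hf : IsSmoothFamily I J f)
    (t : Simplex p) : ContMDiff I J ∞ (fun x => f x t) := by
  obtain ⟨F, hF, hFf⟩ := hf
  have h : (fun x => f x t) = fun x => F (x, t.1) := funext fun x => (hFf x t).symm
  rw [h]
  exact hF.comp_contMDiff (contMDiff_id.prodMk contMDiff_const) fun x => ⟨trivial, t.2⟩

theorem isSmoothFamily_const {p : ℕ} {f : X → Y} (hf : ContMDiff I J ∞ f) :
    IsSmoothFamily I J (fun x (_ : Simplex p) => f x) :=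
  ⟨fun z => f z.1, (hf.comp contMDiff_fst).contMDiffOn, fun _ _ => rfl⟩

end Family

/-! ### The section of the forgetful map and the homotopy over smooth maps -/

section Forget

variable {G : Type v} [Group G] {U : Type u} [NormedAddCommGroup U] [InnerProductSpace ℝ U]
  {ρ : G →* (U ≃ₗᵢ[ℝ] U)}

/-- An equivariant injective immersion of `M` into a finite-dimensional subspace of `U`. -/
structure UniverseEmbedding (ρ : G →* (U ≃ₗᵢ[ℝ] U)) (M : GManifold.{u} G) where
  toFun : M → U
  contMDiff : ContMDiff M.model (modelWithCornersSelf ℝ U) ∞ toFun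
  injective : Function.Injective toFun
  injective_mfderiv :
    ∀ x, Function.Injective (mfderiv M.model (modelWithCornersSelf ℝ U) toFun x)
  equivariant : ∀ (g : G) x, toFun (g • x) = ρ g (toFun x)
  finite : ∃ V : Submodule ℝ U, FiniteDimensional ℝ V ∧ ∀ x, toFun x ∈ V

variable {M₀ M₁ : GManifold.{u} G} (D : Deformation ρ) (i : UniverseEmbedding ρ M₀)

/-- The simplex `σ` of embeddings, moved along a deformation, with time a given map from the simplex
to the interval. -/
noncomputable def EmbSimplex.push {p : ℕ} (σ : EmbSimplex ρ M₀ M₁ p)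
    (α : Fin (p + 1) → Fin 2) : EmbSimplex ρ M₀ M₁ p where
  toFun x t := ((σ.toFun x t).1,
    Deformation.coeff (intervalCoord α t) • D.path (intervalCoord α t) (σ.toFun x t).2 +
      Deformation.coeff' (intervalCoord α t) • D.left (i.toFun x))
  smooth := by
    obtain ⟨V, hV, h⟩ := σ.finite
    exact σ.smooth.fst.prodMk (D.isSmoothFamily σ.smooth.snd V h
      (D.left.toContinuousLinearMap.contMDiff.comp i.contMDiff) α)
  finite := by
    obtain ⟨V, hV, h⟩ := σ.finite
    obtain ⟨V', hV', h'⟩ := i.finite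
    obtain ⟨W, hW, hVW⟩ := D.exists_finiteDimensional V (V'.map D.left.toLinearMap)
    exact ⟨W, hW, fun x t => hVW _ _ (h x t) _ (Submodule.mem_map_of_mem (h' x))⟩
  equivariant_fst := σ.equivariant_fst
  equivariant_snd g x t := by
    simp only [σ.equivariant_snd, i.equivariant, D.path_equivariant, D.left_equivariant, map_add,
      map_smul]
  isSmoothEmb t := IsSmoothEmb.combine (σ.smooth.fst.contMDiff t) (σ.smooth.snd.contMDiff t)
    i.contMDiff i.injective i.injective_mfderiv _ _ _ _
    (fun h => D.inner_path_left _ (Deformation.half_le_of_coeff'_ne_zero h))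
    (fun h => ⟨Deformation.coeff_ne_zero_of_coeff'_eq_zero h, σ.isSmoothEmb t⟩)

/-- The family of embeddings whose first component is a given family of maps, and whose second
component is constant. -/
noncomputable def EmbSimplex.ofSm {p : ℕ} (φ : SmSimplex M₀ M₁ p) : EmbSimplex ρ M₀ M₁ p where
  toFun x t := (φ.toFun x t, D.left (i.toFun x))
  smooth := φ.smooth.prodMk
    (isSmoothFamily_const (D.left.toContinuousLinearMap.contMDiff.comp i.contMDiff))
  finite := by
    obtain ⟨V, hV, h⟩ := i.finite
    exact ⟨V.map D.left.toLinearMap, inferInstance, fun x _ => Submodule.mem_map_of_mem (h x)⟩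
  equivariant_fst := φ.equivariant
  equivariant_snd g x _ := by rw [i.equivariant, D.left_equivariant]
  isSmoothEmb t := by
    -- With coefficients 0 and 1 only `D.left ∘ i` survives; the zero map and `D.right` are
    -- placeholders.
    have h := IsSmoothEmb.combine (φ.smooth.contMDiff t) (contMDiff_const (c := (0 : U)))
      i.contMDiff i.injective i.injective_mfderiv D.right D.left 0 1
      (fun _ u w => by rw [real_inner_comm, D.inner_left_right]) (fun h => absurd h one_ne_zero)
    simpa using h

theorem EmbSimplex.push_reindex {p q : ℕ} (σ : EmbSimplex ρ M₀ M₁ p)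
    (α : Fin (p + 1) → Fin 2) (θ : Fin (q + 1) → Fin (p + 1)) :
    (σ.reindex θ).push D i (α ∘ θ) = (σ.push D i α).reindex θ := by
  refine EmbSimplex.ext (funext fun x => funext fun t => ?_)
  simp only [EmbSimplex.push, EmbSimplex.reindex, intervalCoord_comp]

theorem EmbSimplex.push_zero {p : ℕ} (σ : EmbSimplex ρ M₀ M₁ p) :
    σ.push D i (fun _ => 0) = σ := by
  refine EmbSimplex.ext (funext fun x => funext fun t => ?_)
  simp [EmbSimplex.push, D.path_zero]

theorem EmbSimplex.push_one {p : ℕ} (σ : EmbSimplex ρ M₀ M₁ p) (φ : SmSimplex M₀ M₁ p)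
    (h : ∀ x t, φ.toFun x t = (σ.toFun x t).1) :
    σ.push D i (fun _ => 1) = .ofSm D i φ := by
  refine EmbSimplex.ext (funext fun x => funext fun t => ?_)
  simp [EmbSimplex.push, EmbSimplex.ofSm, h]

/-- A section of the forgetful map, whose components are a constant isometry, the given map, and
a constant embedding. -/
noncomputable def forgetSection (M₁ : GManifold.{u} G) : Sm M₀ M₁ ⟶ UEmb ρ M₀ M₁ where
  app n := ↾fun φ => ⟨(IsometrySimplex.const D.right D.right_equivariant n.unop.len,
      EmbSimplex.ofSm D i φ), fun x t => by
    rintro _ ⟨u, rfl⟩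
    exact (real_inner_comm _ _).trans (D.inner_left_right _ _)⟩
  naturality _ _ _ := rfl

/-- Isometry and embedding are pushed with the same time function, so the pair remains in the
subcomplex. At time 1 nothing of the original pair is left except the first component of the
embedding. -/
theorem isWeakEquivalence_forget (D : Deformation ρ) (i : UniverseEmbedding ρ M₀)
    (M₁ : GManifold.{u} G) :
    IsWeakEquivalence (forget ρ M₀ M₁) := by
  refine IsWeakEquivalence.of_section (forgetSection D i M₁) rfl ?_
  refine HomotopyRel.of_family
    (fun n s α => ⟨(IsometrySimplex.push D s.1.1 α, EmbSimplex.push D i s.1.2 α), fun x t => ?_⟩)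
    (fun n m θ s α => Subtype.ext (Prod.ext (IsometrySimplex.push_reindex D s.1.1 α _)
      (EmbSimplex.push_reindex D i s.1.2 α _)))
    (fun n s => Subtype.ext (Prod.ext (IsometrySimplex.push_zero D s.1.1)
      (EmbSimplex.push_zero D i s.1.2)))
    (fun n s => Subtype.ext (Prod.ext (IsometrySimplex.push_one D s.1.1)
      (EmbSimplex.push_one D i s.1.2 _ fun _ _ => rfl)))
  rintro _ ⟨u, rfl⟩
  exact D.inner_push _ _ (fun u => s.2 x t _ ⟨u, rfl⟩) u (i.toFun x)

end Forget

end UEmbeddings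

theorem mainTheorem10 {G : Type v} [Group G] [Finite G]
    {U : Type u} [NormedAddCommGroup U] [InnerProductSpace ℝ U]
    (ρ : G →* (U ≃ₗᵢ[ℝ] U)) (hU : UEmbeddings.IsCompleteUniverse ρ) :
    UEmbeddings.IsContractible (UEmbeddings.L ρ) ∧
      ∀ M₀ M₁ : UEmbeddings.GManifold.{u} G,
        UEmbeddings.IsWeakEquivalence (UEmbeddings.forget ρ M₀ M₁) := by
  obtain ⟨D⟩ := hU.nonempty_deformation
  refine ⟨D.isContractible_L, fun M₀ M₁ => ?_⟩
  obtain ⟨i, h₁, h₂, h₃, h₄, h₅⟩ := hU.exists_embedding M₀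
  exact UEmbeddings.isWeakEquivalence_forget D ⟨i, h₁, h₂, h₃, h₄, h₅⟩ M₁
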